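/- **Definitions.** A discrete valuation on a field is taken surjective onto $\mathbb Z$. A field $F$ is a *complete discrete valuation field* if it is complete under some discrete valuation; this valuation is then unique, and $\mathcal O_F$, $\overline F$ denote its ring of integers and residue field. Put $F^{(0)}=F$ and, as long as $F^{(i)}$ is a complete discrete valuation field, $F^{(i+1)}=\overline{F^{(i)}}$, the $(i+1)$-st residue field of $F$. Let $\operatorname{cdvdim}F\in\mathbb N\cup\{\infty\}$ be the supremum of the $n$ such that $F^{(0)},\dots,F^{(n-1)}$ are all complete discrete valuation fields. $F$ is an *$n$-dimensional local field* if $\operatorname{cdvdim}F=n$ and $F^{(n)}$ is finite. A *regular $n$-chain* ($n\ge 0$) is a tuple $\underline A=(A,\mathfrak p_n,\dots,\mathfrak p_0)$, where $A$ is a Noetherian regular local ring of dimension $n$ and $\mathfrak p_n\supsetneq\cdots\supsetneq\mathfrak p_0$ are prime ideals of $A$ such that every $A/\mathfrak p_i$ is regular (so $\mathfrak p_n$ is the maximal ideal and $\mathfrak p_0=0$). Put $k(A)=A/\mathfrak p_n$. Let $\operatorname{comp}\underline A=(\hat A,\mathfrak p_n\hat A,\dots,\mathfrak p_0\hat A)$,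 where $\hat A$ is the $\mathfrak p_n$-adic completion of $A$, and, for $n\ge 1$, let $\operatorname{loc}\underline A=(A_{\mathfrak p_{n-1}},\mathfrak p_{n-1}A_{\mathfrak p_{n-1}},\dots,\mathfrak p_0A_{\mathfrak p_{n-1}})$. Applying $\operatorname{loc}\circ\operatorname{comp}$ to $\underline A$ $n$ times leaves a ring with one ideal; that ring is $HL(\underline A)$. It comes with a natural ring homomorphism $j:A\to HL(\underline A)$. **Theorem.** Let $\underline A$ be a regular $n$-chain. Then: 1. $F=HL(\underline A)$ is a field, and $\operatorname{cdvdim}F\ge n$. 2. The $n$-th residue field of $F$ is $k(A)$: there is an isomorphism $e:k(A)\cong F^{(n)}$ such that for every $a\in A$ the element $j(a)$ can be reduced $n$ times in succession (lying each time in the ring of integers of $F^{(i)}$, $i=0,\dots,n-1$), with final reduction $e(a\bmod\mathfrak p_n)$. 3. If $A$ is essentially of finite type over $\mathbb Z$ (a localisation of a finitely generated $\mathbb Z$-algebra), then $\operatorname{cdvdim}F=n$. 4. If $A$ is the localisation of a finitely generated $\mathbb Z$-algebra at a maximal ideal (that is, the local ring at a closed point of a scheme of finite type over $\mathbb Z$),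 then $F$ is an $n$-dimensional local field. -/

import Mathlib

open scoped WithZero

universe u v

noncomputable section

/-! ### Complete discrete valuation fields and their residue fields -/

/-- The field `F` is complete under the normalised (surjective) discrete valuation `v`.
Valuations are written multiplicatively, so `ℤᵐ⁰` stands for `ℤ ∪ {∞}` with reversed order. -/
structure IsCompleteDiscreteValuation {F : Type u} [Field F] (v : Valuation F ℤᵐ⁰) : Prop where
  surjective : Function.Surjective v
  complete : @CompleteSpace F (Valued.mk' v).toUniformSpace

/-- `F` is a complete discrete valuation field. -/
def IsCDVField (F : Type u) [Field F] : Prop :=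
  ∃ v : Valuation F ℤᵐ⁰, IsCompleteDiscreteValuation v

open Classical in
/-- The ring of integers of a complete discrete valuation field `F` (the normalised valuation
under which `F` is complete is unique, so nothing depends on the choice).
If `F` is not a complete discrete valuation field, this is all of `F`. -/
def cdvIntegers (F : Type u) [Field F] : ValuationSubring F :=
  if h : IsCDVField F then h.choose.valuationSubring else ⊤

/-- The residue field of a complete discrete valuation field. -/
abbrev CDVResidueField (F : Type u) [Field F] : Type u :=
  IsLocalRing.ResidueField (cdvIntegers F)

/-- The sequence `F⁽⁰⁾ = F`, `F⁽ⁿ⁺¹⁾ =` residue field of `F⁽ⁿ⁾`, with the field structures. -/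
def nthResidueFieldAux (F : Type u) [Field F] : ℕ → Σ K : Type u, Field K
  | 0 => ⟨F, inferInstance⟩
  | n + 1 =>
    letI := (nthResidueFieldAux F n).2
    ⟨CDVResidueField (nthResidueFieldAux F n).1, inferInstance⟩

/-- The `n`-th residue field `F⁽ⁿ⁾` (meaningful for `n ≤ cdvdim F`). -/
def NthResidueField (n : ℕ) (F : Type u) [Field F] : Type u :=
  (nthResidueFieldAux F n).1

instance (n : ℕ) (F : Type u) [Field F] : Field (NthResidueField n F) :=
  (nthResidueFieldAux F n).2

/-- The complete discrete valuation dimension: the supremum of the `n` such that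
`F⁽⁰⁾, …, F⁽ⁿ⁻¹⁾` are all complete discrete valuation fields. -/
def cdvdim (F : Type u) [Field F] : ℕ∞ :=
  ⨆ (n : ℕ) (_ : ∀ i < n, IsCDVField (NthResidueField i F)), (n : ℕ∞)

/-- `F` is an `n`-dimensional local field. -/
def IsHigherLocalField (n : ℕ) (F : Type u) [Field F] : Prop :=
  cdvdim F = n ∧ Finite (NthResidueField n F)

/-- `ReducesTo F n x y`: the element `x` of `F` can be reduced `n` times in succession (each time
it lies in the ring of integers), and the result is the element `y` of `F⁽ⁿ⁾`. -/
def ReducesTo (F : Type u) [Field F] : (n : ℕ) → F → NthResidueField n F → Prop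
  | 0, x, y => x = y
  | n + 1, x, y => ∃ z : cdvIntegers (NthResidueField n F),
      ReducesTo F n x (z : NthResidueField n F) ∧ IsLocalRing.residue _ z = y

/-! ### Chains of ideals, completion and localisation -/

/-- A commutative ring `A` with a family of ideals `𝔭₀, …, 𝔭ₙ`. -/
structure RingChain (n : ℕ) where
  carrier : Type u
  [commRing : CommRing carrier]
  ideal : Fin (n + 1) → Ideal carrier

namespace RingChain

attribute [instance] RingChain.commRing

/-- Regular chains of length `n`: `A` is a Noetherian regular local ring of dimension `n`, and
`𝔭₀ ⊂ ⋯ ⊂ 𝔭ₙ` is a strictly increasing chain of primes with every `A/𝔭ᵢ` regular. -/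
structure IsRegular {n : ℕ} (A : RingChain.{u} n) : Prop where
  isRegularLocalRing : IsRegularLocalRing A.carrier
  ringKrullDim_eq : ringKrullDim A.carrier = n
  isPrime : ∀ i, (A.ideal i).IsPrime
  isRegularLocalRing_quotient : ∀ i, IsRegularLocalRing (A.carrier ⧸ A.ideal i)
  strictMono : StrictMono A.ideal

/-- `k(A) = A/𝔭ₙ`. -/
abbrev residue {n : ℕ} (A : RingChain.{u} n) : Type u :=
  A.carrier ⧸ A.ideal (Fin.last n)

/-- Complete `A` with respect to `𝔭ₙ` and extend each of the ideals. -/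
def comp {n : ℕ} (A : RingChain.{u} n) : RingChain.{u} n where
  carrier := AdicCompletion (A.ideal (Fin.last n)) A.carrier
  ideal i := (A.ideal i).map
    (algebraMap A.carrier (AdicCompletion (A.ideal (Fin.last n)) A.carrier))

/-- The elements of `R` that are non-zero-divisors modulo `I`;
for a prime ideal this is the complement of `I`. -/
def nonZeroDivisorsMod {R : Type u} [CommRing R] (I : Ideal R) : Submonoid R :=
  (nonZeroDivisors (R ⧸ I)).comap (Ideal.Quotient.mk I)

theorem nonZeroDivisorsMod_eq_primeCompl {R : Type u} [CommRing R] (I : Ideal R) [I.IsPrime] :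
    nonZeroDivisorsMod I = I.primeCompl := by
  ext x
  simp [nonZeroDivisorsMod, Ideal.primeCompl, Ideal.Quotient.eq_zero_iff_mem]

/-- Localise `A` away from `𝔭ₙ₋₁`, drop `𝔭ₙ` and extend each of the remaining ideals. -/
def loc {n : ℕ} (A : RingChain.{u} (n + 1)) : RingChain.{u} n where
  carrier := Localization (nonZeroDivisorsMod (A.ideal (Fin.last n).castSucc))
  ideal i := (A.ideal i.castSucc).map (algebraMap A.carrier
    (Localization (nonZeroDivisorsMod (A.ideal (Fin.last n).castSucc))))

/-- `HL(A)`, the result of applying `loc ∘ comp` to `A` `n` times, as a chain of length `0`. -/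
def HLChain : {n : ℕ} → RingChain.{u} n → RingChain.{u} 0
  | 0, A => A
  | _ + 1, A => HLChain A.comp.loc

/-- The underlying ring of `HL(A)`. -/
abbrev HL {n : ℕ} (A : RingChain.{u} n) : Type u := A.HLChain.carrier

/-- The natural map `A → loc comp A`. -/
def toLocComp {n : ℕ} (A : RingChain.{u} (n + 1)) : A.carrier →+* A.comp.loc.carrier :=
  (algebraMap A.comp.carrier
    (Localization (nonZeroDivisorsMod (A.comp.ideal (Fin.last n).castSucc)))).comp
    (algebraMap A.carrier (AdicCompletion (A.ideal (Fin.last (n + 1))) A.carrier))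

/-- The natural map `A → HL(A)`. -/
def toHL : {n : ℕ} → (A : RingChain.{u} n) → A.carrier →+* A.HL
  | 0, A => RingHom.id A.carrier
  | _ + 1, A => (toHL A.comp.loc).comp A.toLocComp

end RingChain

end

/-! ### Complete discrete valuations -/

section CompleteDiscreteValuation

open WithZero Filter Topology Uniformity MonoidWithZeroHom

/-! Regularity is used only to pass to a weaker condition. In a regular local ring, a prime of
codimension one with regular quotient is principal (`IsRegularLocalRing.exists_eq_span_singleton`),
so each step of a regular chain is generated by one element over the previous prime:
`IsPrincipalPrimeChain`. This condition survives `comp` and `loc`. For `comp`, descend from the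
field Â/𝔭ₙÂ: the ring Â/𝔭ᵢÂ is complete and, modulo one nonzerodivisor, equals the Noetherian domain
Â/𝔭ᵢ₊₁Â, so it is itself a Noetherian domain.

Consequently D = Â/𝔭ₙ₋₁Â is a complete discrete valuation ring with residue field k(A), and Frac D
is the residue field of `loc (comp A)`. Since HL(A) is HL of that shorter chain, induction
identifies its (n-1)-st residue field with Frac D, and one more reduction gives k(A).

Because `cdvIntegers` chooses a valuation, the ring of integers has to be proved unique
(`IsCompleteDiscreteValuation.valuationSubring_eq`). The upper bound on `cdvdim` is a cardinality
argument: complete discrete valuation fields are uncountable, whereas k(A) is countable when A is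
essentially of finite type over ℤ. At a closed point, k(A) is finite by the Nullstellensatz over ℤ.
-/

theorem WithZero.lt_exp_iff_le_exp_sub_one {x : ℤᵐ⁰} {n : ℤ} : x < exp n ↔ x ≤ exp (n - 1) := by
  rcases eq_or_ne x 0 with rfl | hx
  · simp
  · rw [← exp_log hx, exp_lt_exp, exp_le_exp]; lia

theorem WithZero.lt_one_iff_le_exp {x : ℤᵐ⁰} : x < 1 ↔ x ≤ exp (-1) := by
  rw [← exp_zero, WithZero.lt_exp_iff_le_exp_sub_one]; rfl

theorem WithZero.eq_zero_of_forall_le_exp {x : ℤᵐ⁰} (h : ∀ k : ℕ, x ≤ exp (-(k : ℤ))) : x = 0 := by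
  by_contra hx
  have := h ((log x).natAbs + 1)
  rw [← exp_log hx, exp_le_exp, log_exp] at this
  omega

variable {F : Type u} [Field F] {v : Valuation F ℤᵐ⁰}

/-- The `Valued` uniformity is indexed by units of the value group of `v`; surjectivity puts every
`exp (-k)` in that group. The resulting countable basis lets completeness be tested on sequences. -/
theorem Valuation.hasBasis_uniformity_exp (hv : Function.Surjective v) :
    (@uniformity F (Valued.mk' v).toUniformSpace).HasBasis (fun _ : ℕ ↦ True)
      fun k ↦ {p | v (p.2 - p.1) ≤ exp (-(k : ℤ))} := by
  let := Valued.mk' v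
  refine (Valued.hasBasis_uniformity F ℤᵐ⁰).to_hasBasis (fun γ _ ↦ ?_) (fun k _ ↦ ?_)
  · have hγ : ValueGroup₀.embedding γ.1 ≠ 0 := by simp
    refine ⟨(log (ValueGroup₀.embedding γ.1)).natAbs + 1, trivial, fun p hp ↦ ?_⟩
    change v.restrict _ < _
    rw [Valuation.restrict_lt_iff_lt_embedding]
    refine lt_of_le_of_lt hp ?_
    rw [← exp_log hγ, exp_lt_exp, log_exp]
    omega
  · obtain ⟨y, hy⟩ := hv (exp (-(k : ℤ)))
    have hy0 : y ≠ 0 := fun h ↦ exp_ne_zero (hy ▸ h ▸ map_zero v)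
    refine ⟨Units.mk0 (v.restrict y) (by simpa using hy0), trivial, fun p hp ↦ ?_⟩
    have hp : v.restrict (p.2 - p.1) < v.restrict y := hp
    rw [Valuation.restrict_lt_iff, hy] at hp
    exact hp.le

theorem Valuation.map_sub_le_exp_of_succ {u : ℕ → F}
    (hu : ∀ k : ℕ, v (u (k + 1) - u k) ≤ exp (-(k : ℤ))) {k m : ℕ} (hkm : k ≤ m) :
    v (u m - u k) ≤ exp (-(k : ℤ)) := by
  induction m, hkm using Nat.le_induction with
  | base => simp
  | succ m hm ih =>
    rw [show u (m + 1) - u k = (u (m + 1) - u m) + (u m - u k) by ring]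
    exact v.map_add_le ((hu m).trans (exp_le_exp.2 (by omega))) ih

namespace IsCompleteDiscreteValuation

/-- With `of_exists_limit`, this turns completeness into a statement about sequences with a fixed
rate. By the ultrametric inequality the rate for consecutive terms is also the rate for the limit.
-/
theorem exists_limit (hv : IsCompleteDiscreteValuation v) {u : ℕ → F}
    (hu : ∀ k : ℕ, v (u (k + 1) - u k) ≤ exp (-(k : ℤ))) :
    ∃ L, ∀ k : ℕ, v (L - u k) ≤ exp (-(k : ℤ)) := by
  let := Valued.mk' v
  have : CompleteSpace F := hv.complete
  have hb := Valuation.hasBasis_uniformity_exp hv.surjective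
  have hc : CauchySeq u := by
    refine hb.cauchySeq_iff'.2 fun k _ ↦ ⟨k, fun m hm ↦ ?_⟩
    change v (u k - u m) ≤ _
    rw [Valuation.map_sub_swap]
    exact Valuation.map_sub_le_exp_of_succ hu hm
  obtain ⟨L, hL⟩ := cauchySeq_tendsto_of_complete hc
  refine ⟨L, fun k ↦ ?_⟩
  have h1 := (nhds_basis_uniformity' (x := L) hb).mem_of_mem (i := k) trivial
  obtain ⟨m, hm, hkm⟩ := ((hL.eventually h1).and (eventually_ge_atTop k)).exists
  have hm : v (u m - L) ≤ _ := hm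
  rw [show L - u k = (L - u m) + (u m - u k) by ring]
  rw [Valuation.map_sub_swap] at hm
  exact v.map_add_le hm (Valuation.map_sub_le_exp_of_succ hu hkm)

theorem of_exists_limit (hs : Function.Surjective v)
    (h : ∀ u : ℕ → F, (∀ k : ℕ, v (u (k + 1) - u k) ≤ exp (-(k : ℤ))) →
      ∃ L, ∀ k : ℕ, v (L - u k) ≤ exp (-(k : ℤ))) : IsCompleteDiscreteValuation v := by
  refine ⟨hs, ?_⟩
  let := Valued.mk' v
  have hb := Valuation.hasBasis_uniformity_exp hs
  have : (𝓤 F).IsCountablyGenerated := hb.isCountablyGenerated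
  refine UniformSpace.complete_of_convergent_controlled_sequences
    (fun k : ℕ ↦ {p : F × F | v (p.2 - p.1) ≤ exp (-(k : ℤ))})
    (fun k ↦ hb.mem_of_mem trivial) fun u hu ↦ ?_
  obtain ⟨L, hL⟩ := h u fun k ↦ hu k k (k + 1) le_rfl (Nat.le_succ k)
  refine ⟨L, ((nhds_basis_uniformity' hb).tendsto_right_iff).2 fun k _ ↦ ?_⟩
  filter_upwards [eventually_ge_atTop k] with m hm
  change v (u m - L) ≤ _
  rw [Valuation.map_sub_swap]
  exact (hL m).trans (exp_le_exp.2 (by omega))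

/-- Hensel's lemma for the polynomial `T ^ 2 - T - x`. -/
theorem exists_sq_sub_self_eq (hv : IsCompleteDiscreteValuation v) {x : F} (hx : v x < 1) :
    ∃ t, v t < 1 ∧ t ^ 2 - t = x := by
  -- A solution is a fixed point of `s ↦ s ^ 2 - x`. This map contracts the maximal ideal, because
  -- `a ^ 2 - b ^ 2 = (a - b) * (a + b)` and `v (a + b) < 1`.
  let u : ℕ → F := fun k ↦ (fun s ↦ s ^ 2 - x)^[k] 0
  have u_succ (k) : u (k + 1) = u k ^ 2 - x := Function.iterate_succ_apply' _ _ _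
  have hu1 (k) : v (u k) < 1 := by
    induction k with
    | zero => simp [u]
    | succ k ih =>
      rw [u_succ]
      refine v.map_sub_lt ?_ hx
      rw [map_pow]
      exact pow_lt_one₀ zero_le ih two_ne_zero
  have hu (k : ℕ) : v (u (k + 1) - u k) ≤ exp (-(k : ℤ)) := by
    induction k with
    | zero => exact (v.map_sub_lt (hu1 _) (hu1 _)).le
    | succ k ih =>
      rw [u_succ (k + 1)]
      nth_rw 2 [u_succ k]
      rw [show u (k + 1) ^ 2 - x - (u k ^ 2 - x) = (u (k + 1) - u k) * (u (k + 1) + u k) by ring,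
        map_mul, show (-((k + 1 : ℕ) : ℤ)) = -(k : ℤ) + -1 by push_cast; ring, exp_add]
      exact mul_le_mul' ih (WithZero.lt_one_iff_le_exp.1 (v.map_add_lt (hu1 _) (hu1 _)))
  obtain ⟨L, hL⟩ := hv.exists_limit hu
  have hL1 : v L < 1 := by
    rw [show L = (L - u 1) + u 1 by ring]
    exact v.map_add_lt (WithZero.lt_one_iff_le_exp.2 (by simpa using hL 1)) (hu1 1)
  refine ⟨L, hL1, ?_⟩
  rw [← sub_eq_zero, ← v.zero_iff]
  refine WithZero.eq_zero_of_forall_le_exp fun k ↦ ?_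
  rw [show L ^ 2 - L - x = (L - u k) * (L + u k) - (L - u (k + 1)) by rw [u_succ]; ring]
  refine v.map_sub_le ?_ ((hL (k + 1)).trans (exp_le_exp.2 (by omega)))
  rw [map_mul]
  exact (mul_le_mul' (hL k) (v.map_add_lt hL1 (hu1 k)).le).trans_eq (mul_one _)

/-- Infinite descent: if `w x > 1`, solve `t ^ 2 - t = x` with `v t < 1`. Then `w t > 1` and `w x =
w t ^ 2`, so `t` is again a counterexample, with half the logarithm. -/
theorem le_one_of_lt_one (hv : IsCompleteDiscreteValuation v) (w : Valuation F ℤᵐ⁰) {x : F}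
    (hx : v x < 1) : w x ≤ 1 := by
  suffices H : ∀ (n : ℕ) (x : F), v x < 1 → w x ≠ 0 → log (w x) ≤ n → log (w x) ≤ 0 by
    rcases eq_or_ne (w x) 0 with h0 | h0
    · simp [h0]
    · rw [← exp_log h0, ← exp_zero, exp_le_exp]
      exact H _ x hx h0 (Int.le_natAbs)
  intro n
  induction n using Nat.strong_induction_on with
  | _ n ih =>
    intro x hx h0 hn
    by_contra! hpos
    obtain ⟨t, ht, rfl⟩ := hv.exists_sq_sub_self_eq hx
    have ht1 : 1 < w t := by
      by_contra! h
      have : w (t ^ 2 - t) ≤ 1 :=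
        w.map_sub_le (by rw [map_pow]; exact pow_le_one₀ zero_le h) h
      rw [← exp_log h0, ← exp_zero, exp_le_exp] at this
      omega
    have ht0 : w t ≠ 0 := (zero_le.trans_lt ht1).ne'
    have hlt : 0 < log (w t) := by rwa [← exp_lt_exp, exp_log ht0, exp_zero]
    have e : w (t ^ 2 - t) = w (t ^ 2) := by
      refine Valuation.map_sub_eq_of_lt_left w ?_
      rw [map_pow]
      exact lt_self_pow₀ ht1 one_lt_two
    rw [e, map_pow, log_pow, nsmul_eq_mul] at hn hpos
    push_cast at hn hpos
    have := ih (n - 1) (by omega) t ht ht0 (by omega)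
    omega

/-- A field has at most one ring of integers for a complete discrete valuation. -/
theorem valuationSubring_eq (hv : IsCompleteDiscreteValuation v) {w : Valuation F ℤᵐ⁰}
    (hw : Function.Surjective w) : w.valuationSubring = v.valuationSubring := by
  obtain ⟨π, hπ⟩ := hv.surjective (exp (-1))
  -- All `x ^ k * π` lie in the maximal ideal of `v`, so `w x ^ k * w π` stays bounded by 1; this is
  -- impossible for large `k` if `w x > 1`.
  have key {x : F} (hx : v x ≤ 1) : w x ≤ 1 := by
    have hpow (k : ℕ) : w (x ^ k * π) ≤ 1 := by
      refine hv.le_one_of_lt_one w ?_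
      rw [map_mul, map_pow]
      refine mul_lt_of_le_one_of_lt (pow_le_one₀ zero_le hx) ?_
      rw [hπ, WithZero.lt_one_iff_le_exp]
    have hπ0 : w π ≠ 0 := by
      rw [w.ne_zero_iff]; rintro rfl; rw [map_zero] at hπ; exact exp_ne_zero hπ.symm
    rcases eq_or_ne (w x) 0 with h0 | h0
    · simp [h0]
    by_contra! h
    have hlt : 0 < log (w x) := by rwa [← exp_lt_exp, exp_log h0, exp_zero]
    have := hpow ((log (w π)).natAbs + 1)
    rw [← exp_log (x := w (x ^ _ * π)) (by simp [h0, hπ0]), ← exp_zero, exp_le_exp, map_mul, map_pow,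
      log_mul (pow_ne_zero _ h0) hπ0, log_pow, nsmul_eq_mul] at this
    push_cast at this
    nlinarith [neg_abs_le (log (w π)), abs_nonneg (log (w π))]
  -- If `v x > 1`, dividing `y` by a high power of `x` makes it `v`-integral, hence `w`-integral by
  -- `key`; with `w x ≤ 1` this would force `w y ≤ 1`.
  have hlt1 {x : F} (hx : w x ≤ 1) : v x ≤ 1 := by
    by_contra! h
    obtain ⟨y, hy⟩ := hw (exp 1)
    have hv0 : v x ≠ 0 := (zero_le.trans_lt h).ne'
    have hlt : 0 < log (v x) := by rwa [← exp_lt_exp, exp_log hv0, exp_zero]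
    have hy0 : v y ≠ 0 := by
      rw [v.ne_zero_iff]; rintro rfl; rw [map_zero] at hy; exact exp_ne_zero hy.symm
    have hx0 : w x ≠ 0 := by
      rw [w.ne_zero_iff]; rintro rfl; simp at hv0
    have := key (x := y * (x ^ (log (v y)).natAbs)⁻¹) (by
      rw [map_mul, map_inv₀, map_pow, mul_inv_le_iff₀ (pow_pos (zero_lt_iff.2 hv0) _), one_mul,
        ← exp_log hy0, ← exp_log (pow_ne_zero _ hv0), exp_le_exp, log_pow, nsmul_eq_mul, log_exp]
      push_cast
      nlinarith [le_abs_self (log (v y)), abs_nonneg (log (v y))])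
    rw [map_mul, map_inv₀, map_pow, mul_inv_le_iff₀ (pow_pos (zero_lt_iff.2 hx0) _), one_mul, hy]
      at this
    have h2 := this.trans (pow_le_one₀ zero_le hx)
    rw [← exp_zero, exp_le_exp] at h2
    omega
  ext x
  exact ⟨hlt1, key⟩

/-- Diagonal argument: at stage `k` the candidates `a` and `a + π ^ k` are too far apart for both to
lie within `exp (-(k + 1))` of `f k`. The limit of the choices thus differs from every `f k`. -/
theorem not_countable (hv : IsCompleteDiscreteValuation v) : ¬ Countable F := by
  intro hF
  obtain ⟨f, hf⟩ := exists_surjective_nat F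
  obtain ⟨π, hπ⟩ := hv.surjective (exp (-1))
  have hπk (k : ℕ) : v (π ^ k) = exp (-(k : ℤ)) := by
    rw [map_pow, hπ, ← exp_nsmul]; simp
  have step (k : ℕ) (a : F) : ∃ b, v (b - a) ≤ exp (-(k : ℤ)) ∧
      exp (-((k + 1 : ℕ) : ℤ)) < v (f k - b) := by
    by_contra! h
    have h1 := h a (by simp)
    have h2 := h (a + π ^ k) (by rw [add_sub_cancel_left, hπk])
    have h3 := v.map_sub_le h1 h2
    rw [show f k - a - (f k - (a + π ^ k)) = π ^ k by ring, hπk, exp_le_exp] at h3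
    omega
  choose g hg1 hg2 using step
  let u : ℕ → F := fun k ↦ Nat.rec 0 (fun k a ↦ g k a) k
  have hu (k : ℕ) : u (k + 1) = g k (u k) := rfl
  obtain ⟨L, hL⟩ := hv.exists_limit (u := u) fun k ↦ by rw [hu]; exact hg1 _ _
  obtain ⟨k, rfl⟩ := hf L
  exact absurd (hL (k + 1)) (not_le.2 (by rw [hu]; exact hg2 _ _))

theorem cdvIntegers_eq (hv : IsCompleteDiscreteValuation v) :
    cdvIntegers F = v.valuationSubring := by
  have h : IsCDVField F := ⟨v, hv⟩
  rw [cdvIntegers, dif_pos h]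
  exact hv.valuationSubring_eq h.choose_spec.surjective

end IsCompleteDiscreteValuation

theorem IsCDVField.not_countable (h : IsCDVField F) : ¬ Countable F :=
  h.elim fun _ hv ↦ hv.not_countable

open IsDedekindDomain in
theorem isCompleteDiscreteValuation_of_isAdicComplete (D : Type v) [CommRing D] [IsDomain D]
    [IsDiscreteValuationRing D] [IsAdicComplete (IsLocalRing.maximalIdeal D) D] [Algebra D F]
    [IsFractionRing D F] : IsCompleteDiscreteValuation
      ((IsDiscreteValuationRing.maximalIdeal D).valuation F) := by
  set w := (IsDiscreteValuationRing.maximalIdeal D).valuation F with hw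
  have hmem (x : D) (k : ℕ) : w (algebraMap D F x) ≤ exp (-(k : ℤ)) ↔
      x ∈ IsLocalRing.maximalIdeal D ^ k := by
    rw [hw, HeightOneSpectrum.valuation_of_algebraMap,
      HeightOneSpectrum.intValuation_le_pow_iff_mem]
    rfl
  refine .of_exists_limit (HeightOneSpectrum.valuation_surjective F _) fun u hu ↦ ?_
  -- Subtracting `u 0` moves the whole sequence into `D`, where adic completeness applies.
  have hd (k : ℕ) : ∃ d : D, algebraMap D F d = u k - u 0 := by
    refine IsDiscreteValuationRing.exists_lift_of_le_one ?_
    simpa using Valuation.map_sub_le_exp_of_succ hu (Nat.zero_le k)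
  choose d hd using hd
  obtain ⟨L, hL⟩ := IsPrecomplete.prec (I := IsLocalRing.maximalIdeal D) (M := D) inferInstance
    (f := d) fun {m n} hmn ↦ by
      rw [SModEq.sub_mem, smul_eq_mul, Ideal.mul_top, ← hmem, map_sub, hd, hd,
        sub_sub_sub_cancel_right, Valuation.map_sub_swap]
      exact Valuation.map_sub_le_exp_of_succ hu hmn
  refine ⟨algebraMap D F L + u 0, fun k ↦ ?_⟩
  have := hL k
  rw [SModEq.sub_mem, smul_eq_mul, Ideal.mul_top, ← hmem, map_sub, hd, Valuation.map_sub_swap] at this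
  rwa [show algebraMap D F L + u 0 - u k = algebraMap D F L - (u k - u 0) by ring]

theorem mem_cdvIntegers_iff (D : Type v) [CommRing D] [IsDomain D]
    [IsDiscreteValuationRing D] [IsAdicComplete (IsLocalRing.maximalIdeal D) D] [Algebra D F]
    [IsFractionRing D F] {x : F} : x ∈ cdvIntegers F ↔ ∃ d, algebraMap D F d = x := by
  rw [(isCompleteDiscreteValuation_of_isAdicComplete (F := F) D).cdvIntegers_eq]
  refine ⟨fun h ↦ IsDiscreteValuationRing.exists_lift_of_le_one h, ?_⟩
  rintro ⟨d, rfl⟩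
  exact IsDedekindDomain.HeightOneSpectrum.valuation_le_one _ _

end CompleteDiscreteValuation

/-! ### Regular local rings -/

section RegularLocalRing

open IsLocalRing Ideal

variable {R : Type u} [CommRing R]

theorem IsLocalRing.map_mk_maximalIdeal [IsLocalRing R] (I : Ideal R) [IsLocalRing (R ⧸ I)] :
    (maximalIdeal R).map (Ideal.Quotient.mk I) = maximalIdeal (R ⧸ I) := by
  have h := comap_isMaximal_of_surjective (Ideal.Quotient.mk I) Ideal.Quotient.mk_surjective
    (K := maximalIdeal (R ⧸ I))
  rw [← IsLocalRing.eq_maximalIdeal h, map_comap_of_surjective _ Ideal.Quotient.mk_surjective]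

theorem IsLocalRing.quotient_span_singleton [IsLocalRing R] {t : R} (ht : t ∈ maximalIdeal R) :
    IsLocalRing (R ⧸ span {t}) := by
  have : Nontrivial (R ⧸ span {t}) := Ideal.Quotient.nontrivial_iff.2 fun h ↦
    (maximalIdeal.isMaximal R).ne_top (top_le_iff.1 (h ▸ (span_singleton_le_iff_mem _).2 ht))
  exact IsLocalRing.of_surjective' _ Ideal.Quotient.mk_surjective

/-- Write `t` in a minimal generating set of the maximal ideal. Since `t ∉ 𝔪 ^ 2`, some coefficient
is a unit, and the corresponding generator becomes redundant modulo `t`. -/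
theorem IsLocalRing.spanFinrank_quotient_span_singleton_add_one_le [IsLocalRing R]
    [IsNoetherianRing R] {t : R} (ht : t ∈ maximalIdeal R) (ht2 : t ∉ maximalIdeal R ^ 2)
    [IsLocalRing (R ⧸ span {t})] :
    (maximalIdeal (R ⧸ span {t})).spanFinrank + 1 ≤ (maximalIdeal R).spanFinrank := by
  classical
  have hfg : (maximalIdeal R).FG := (maximalIdeal R).fg_of_isNoetherianRing
  set g := (Submodule.FG.finite_generators hfg).toFinset with hg
  have hcard : g.card = (maximalIdeal R).spanFinrank := by
    rw [← Submodule.FG.generators_ncard hfg, Set.ncard_eq_toFinset_card _ (Submodule.FG.finite_generators hfg)]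
  have hspan : span (g : Set R) = maximalIdeal R := by
    rw [hg, Set.Finite.coe_toFinset]; exact Submodule.span_generators _
  obtain ⟨c, -, hc⟩ := Submodule.mem_span_finset.1 (hspan ▸ ht : t ∈ span (g : Set R))
  have hgm {a} (ha : a ∈ g) : a ∈ maximalIdeal R := hspan ▸ subset_span ha
  obtain ⟨a, hag, hca⟩ : ∃ a ∈ g, c a ∉ maximalIdeal R := by
    by_contra! h
    refine ht2 (hc ▸ Ideal.sum_mem _ fun a ha ↦ ?_)
    rw [pow_two]
    exact mul_mem_mul (h a ha) (hgm ha)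
  have hu : IsUnit (c a) := by simpa using hca
  have key : maximalIdeal (R ⧸ span {t}) =
      span ((Ideal.Quotient.mk (span {t})) '' (g.erase a : Set R)) := by
    rw [← IsLocalRing.map_mk_maximalIdeal, ← hspan, map_span]
    refine le_antisymm (span_le.2 ?_) (span_mono (Set.image_mono (by simp)))
    rintro _ ⟨b, hb, rfl⟩
    by_cases hba : b = a
    · subst hba
      have h0 : Ideal.Quotient.mk (span {t}) (∑ a ∈ g, c a • a) = 0 := by
        rw [hc]; exact Ideal.Quotient.eq_zero_iff_mem.2 (mem_span_singleton_self t)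
      rw [← Finset.add_sum_erase _ _ hag, map_add, smul_eq_mul, map_mul] at h0
      refine (unit_mul_mem_iff_mem _ (hu.map (Ideal.Quotient.mk (span {t})))).1 ?_
      rw [eq_neg_of_add_eq_zero_left h0, neg_mem_iff, map_sum]
      refine Ideal.sum_mem _ fun x hx ↦ ?_
      rw [smul_eq_mul, map_mul]
      exact mul_mem_left _ _ (subset_span ⟨x, hx, rfl⟩)
    · exact subset_span ⟨b, by simpa [hba] using hb, rfl⟩
  rw [key, ← hcard, ← Finset.card_erase_add_one hag]
  refine Nat.add_le_add_right ?_ 1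
  have hfin := (g.erase a).finite_toSet
  refine (Submodule.spanFinrank_span_le_ncard_of_finite (hfin.image _)).trans ?_
  refine (Set.ncard_image_le hfin).trans ?_
  rw [Set.ncard_coe_finset]

/-- Lifts of generators of `𝔪 / P` generate `𝔪` modulo `𝔪 ^ 2`, hence generate `𝔪` by Nakayama. -/
theorem IsLocalRing.spanFinrank_le_quotient_of_le_sq [IsLocalRing R] [IsNoetherianRing R]
    {P : Ideal R} (hP : P ≤ maximalIdeal R ^ 2) [IsLocalRing (R ⧸ P)] :
    (maximalIdeal R).spanFinrank ≤ (maximalIdeal (R ⧸ P)).spanFinrank := by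
  have hfg : (maximalIdeal (R ⧸ P)).FG := (maximalIdeal (R ⧸ P)).fg_of_isNoetherianRing
  set g := (maximalIdeal (R ⧸ P)).generators
  have hgf : g.Finite := Submodule.FG.finite_generators hfg
  have hspan : span g = maximalIdeal (R ⧸ P) := Submodule.span_generators _
  let s := Function.surjInv (Ideal.Quotient.mk_surjective (I := P))
  have hs : Ideal.Quotient.mk P '' (s '' g) = g := by
    rw [← Set.image_comp]
    simp [s, Function.surjInv_eq]
  have hle : maximalIdeal R ≤ span (s '' g) ⊔ maximalIdeal R • maximalIdeal R := by
    intro x hx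
    have h1 : Ideal.Quotient.mk P x ∈ (span (s '' g)).map (Ideal.Quotient.mk P) := by
      rw [map_span, hs, hspan, ← IsLocalRing.map_mk_maximalIdeal]
      exact mem_map_of_mem _ hx
    obtain ⟨y, hy, hxy⟩ := (mem_map_iff_of_surjective _ Ideal.Quotient.mk_surjective).1 h1
    have h2 : x - y ∈ maximalIdeal R • maximalIdeal R := by
      rw [smul_eq_mul, ← pow_two]
      exact hP (Ideal.Quotient.eq.1 hxy.symm)
    exact Submodule.mem_sup.2 ⟨y, hy, x - y, h2, by ring⟩
  have hge : span (s '' g) ≤ maximalIdeal R := by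
    rw [span_le]
    rintro _ ⟨b, hb, rfl⟩
    have hb : b ∈ maximalIdeal (R ⧸ P) := hspan ▸ subset_span hb
    by_contra h
    have hu : IsUnit (s b) := by simpa using h
    have := hu.map (Ideal.Quotient.mk P)
    rw [show Ideal.Quotient.mk P (s b) = b from Function.surjInv_eq _ b] at this
    exact hb this
  have heq : maximalIdeal R = span (s '' g) := le_antisymm
    (Submodule.le_of_le_smul_of_le_jacobson_bot (maximalIdeal R).fg_of_isNoetherianRing
      (maximalIdeal_le_jacobson _) hle) hge
  rw [heq, ← Submodule.FG.generators_ncard hfg]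
  exact (Submodule.spanFinrank_span_le_ncard_of_finite (hgf.image _)).trans (Set.ncard_image_le hgf)

namespace IsRegularLocalRing

/-- The embedding dimension drops by at least one, the Krull dimension by at most one, and the
latter never exceeds the former. -/
theorem quotient_span_singleton [IsRegularLocalRing R] {t : R} (ht : t ∈ maximalIdeal R)
    (ht2 : t ∉ maximalIdeal R ^ 2) : IsRegularLocalRing (R ⧸ span {t}) ∧
      ringKrullDim (R ⧸ span {t}) + 1 = ringKrullDim R := by
  have : IsLocalRing (R ⧸ span {t}) := IsLocalRing.quotient_span_singleton ht
  have h1 := IsLocalRing.spanFinrank_quotient_span_singleton_add_one_le ht ht2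
  have h1' : ((maximalIdeal (R ⧸ span {t})).spanFinrank : WithBot ℕ∞) + 1 ≤
      (maximalIdeal R).spanFinrank := by exact_mod_cast h1
  rw [‹IsRegularLocalRing R›.spanFinrank_maximalIdeal] at h1'
  have h2 : ringKrullDim R ≤ ringKrullDim (R ⧸ span {t}) + 1 := by
    have := ringKrullDim_le_ringKrullDim_quotient_add_card (R := R) {t} (by
      simpa [← Ideal.jacobson_bot, IsLocalRing.jacobson_eq_maximalIdeal ⊥ bot_ne_top] using ht)
    rwa [Finset.coe_singleton, Finset.card_singleton, Nat.cast_one] at this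
  have h3 := ringKrullDim_le_spanFinrank_maximalIdeal (R ⧸ span {t})
  have h4 := h1'.trans h2
  refine ⟨of_spanFinrank_maximalIdeal_le _ ?_,
    le_antisymm ((add_le_add_left h3 1).trans h1') h2⟩
  exact ENat.WithBot.add_le_add_one_right_iff.1 h4

/-- Induction on the embedding dimension. For `t` outside `𝔪 ^ 2` and all minimal primes, `(t)` is
prime by induction; a minimal prime `q ⊆ (t)` satisfies `q = t q`, so `q = 0` by Nakayama. -/
theorem isDomain [IsRegularLocalRing R] : IsDomain R := by
  obtain ⟨d, hd⟩ : ∃ d, (maximalIdeal R).spanFinrank = d := ⟨_, rfl⟩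
  induction d generalizing R with
  | zero =>
    have h : maximalIdeal R = ⊥ :=
      (Submodule.spanFinrank_eq_zero_iff_eq_bot (maximalIdeal R).fg_of_isNoetherianRing).1 hd
    exact (isField_iff_maximalIdeal_eq.2 h).isDomain
  | succ d ih =>
    have hdim : ringKrullDim R = (d + 1 : ℕ) := by
      rw [← hd, IsRegularLocalRing.spanFinrank_maximalIdeal]
    obtain ⟨t, ht, ht2, htq⟩ : ∃ t ∈ maximalIdeal R, t ∉ maximalIdeal R ^ 2 ∧
        ∀ q ∈ minimalPrimes R, t ∉ q := by
      by_contra! h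
      have hsub : (maximalIdeal R : Set R) ⊆
          ⋃ q ∈ insert (maximalIdeal R ^ 2) (minimalPrimes R), (q : Set R) := by
        intro t ht
        by_cases ht2 : t ∈ maximalIdeal R ^ 2
        · exact Set.mem_biUnion (Set.mem_insert _ _) ht2
        · obtain ⟨q, hq, htq⟩ := h t ht ht2
          exact Set.mem_biUnion (Set.mem_insert_of_mem _ hq) htq
      -- Prime avoidance allows two non-prime ideals; `𝔪 ^ 2` fills both slots.
      obtain ⟨q, hq, hle⟩ := (subset_union_prime_finite (f := id)
        ((minimalPrimes.finite_of_isNoetherianRing R).insert _)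
        (maximalIdeal R ^ 2) (maximalIdeal R ^ 2) (fun i hi hi1 _ ↦
          ((Set.mem_insert_iff.1 hi).resolve_left hi1).1.1)).1 hsub
      rcases Set.mem_insert_iff.1 hq with rfl | hq
      · have : maximalIdeal R = ⊥ := Submodule.eq_bot_of_le_smul_of_le_jacobson_bot _ _
          (maximalIdeal R).fg_of_isNoetherianRing (by rwa [smul_eq_mul, ← pow_two])
          (maximalIdeal_le_jacobson _)
        rw [this, Submodule.spanFinrank_bot] at hd
        omega
      · have hqp : q.IsPrime := hq.1.1
        have hqm : q = maximalIdeal R := le_antisymm (le_maximalIdeal hqp.ne_top) hle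
        have := height_eq_zero_iff.2 hq
        rw [hqm] at this
        rw [← maximalIdeal_height_eq_ringKrullDim, this] at hdim
        norm_cast at hdim
    obtain ⟨hreg, hdim'⟩ := quotient_span_singleton ht ht2
    have : IsDomain (R ⧸ span {t}) := ih (by
      rw [hdim, ← hreg.spanFinrank_maximalIdeal] at hdim'
      norm_cast at hdim'
      omega)
    have hprime : (span {t}).IsPrime := (Ideal.Quotient.isDomain_iff_prime _).1 this
    obtain ⟨q, hq, hqt⟩ := exists_minimalPrimes_le (I := ⊥) (J := span {t}) bot_le
    have hqp : q.IsPrime := hq.1.1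
    have hq0 : q = ⊥ := by
      refine Submodule.eq_bot_of_le_smul_of_le_jacobson_bot (maximalIdeal R) _
        q.fg_of_isNoetherianRing (fun x hx ↦ ?_) (maximalIdeal_le_jacobson _)
      obtain ⟨y, rfl⟩ := mem_span_singleton.1 (hqt hx)
      exact Submodule.smul_mem_smul ht ((hqp.mem_or_mem hx).resolve_left (htq q hq))
    have : (⊥ : Ideal R).IsPrime := hq0 ▸ hqp
    exact IsDomain.of_bot_isPrime R

end IsRegularLocalRing

theorem ringKrullDim_quotient_add_one_le_of_ne_bot [IsDomain R] {P : Ideal R} (hP : P ≠ ⊥) :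
    ringKrullDim (R ⧸ P) + 1 ≤ ringKrullDim R := by
  obtain ⟨x, hx, hx0⟩ := Submodule.exists_mem_ne_zero_of_ne_bot hP
  have h := ringKrullDim_quotient_succ_le_of_nonZeroDivisor (mem_nonZeroDivisors_of_ne_zero hx0)
  have h2 := ringKrullDim_le_of_surjective (Ideal.Quotient.factor ((span_singleton_le_iff_mem P).2 hx))
    (Ideal.Quotient.factor_surjective _)
  exact (add_le_add_left h2 1).trans h

/-- In a regular local ring, a prime with regular quotient of codimension one is principal. -/
theorem IsRegularLocalRing.exists_eq_span_singleton [IsRegularLocalRing R] {P : Ideal R}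
    [P.IsPrime] [IsRegularLocalRing (R ⧸ P)] (hdim : ringKrullDim (R ⧸ P) + 1 = ringKrullDim R) :
    ∃ t, P = span {t} := by
  have hPm : P ≤ maximalIdeal R := le_maximalIdeal (IsPrime.ne_top ‹_›)
  -- Otherwise `R` and `R ⧸ P`, both regular, would violate the dimension hypothesis through their
  -- embedding dimensions.
  have hP2 : ¬ P ≤ maximalIdeal R ^ 2 := by
    intro h
    have h1 := IsLocalRing.spanFinrank_le_quotient_of_le_sq h
    rw [← IsRegularLocalRing.spanFinrank_maximalIdeal,
      ← IsRegularLocalRing.spanFinrank_maximalIdeal] at hdim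
    norm_cast at hdim
    omega
  obtain ⟨t, htP, ht2⟩ := SetLike.not_le_iff_exists.1 hP2
  obtain ⟨hreg, hdim'⟩ := IsRegularLocalRing.quotient_span_singleton (hPm htP) ht2
  have : IsDomain (R ⧸ span {t}) := IsRegularLocalRing.isDomain
  have hle : span {t} ≤ P := (span_singleton_le_iff_mem P).2 htP
  refine ⟨t, le_antisymm ?_ hle⟩
  -- `R ⧸ (t)` is a domain of the same dimension as `R ⧸ P`, so the image of `P` in it cannot be
  -- nonzero.
  by_contra hlt
  have h0 : P.map (Ideal.Quotient.mk (span {t})) ≠ ⊥ := by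
    rw [Ne, map_eq_bot_iff_le_ker, mk_ker]; exact hlt
  have h1 := ringKrullDim_quotient_add_one_le_of_ne_bot h0
  rw [ringKrullDim_eq_of_ringEquiv (DoubleQuot.quotQuotEquivQuotOfLE hle), hdim, ← hdim',
    ← hreg.spanFinrank_maximalIdeal] at h1
  norm_cast at h1
  omega

end RegularLocalRing

/-! ### Regular chains have principal steps -/

namespace RingChain

open Ideal

/-- A chain of primes in a Noetherian ring, from `⊥` to a maximal ideal, in which every step is
principal modulo the previous ideal. -/
structure IsPrincipalPrimeChain {n : ℕ} (A : RingChain.{u} n) : Prop where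
  isNoetherianRing : IsNoetherianRing A.carrier
  isPrime : ∀ i, (A.ideal i).IsPrime
  ideal_zero : A.ideal 0 = ⊥
  isMaximal : (A.ideal (Fin.last n)).IsMaximal
  exists_succ_eq : ∀ i : Fin n, ∃ t ∉ A.ideal i.castSucc, A.ideal i.succ = A.ideal i.castSucc ⊔ span {t}

/-- Each strict inclusion of primes lowers the dimension by at least one, so dim(A/𝔭ᵢ) + i is
antitone. It is at most n at the start and at least n at the end, hence constant. -/
theorem IsRegular.ringKrullDim_quotient_add {n : ℕ} {A : RingChain.{u} n} (hA : A.IsRegular)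
    (i : Fin (n + 1)) : ringKrullDim (A.carrier ⧸ A.ideal i) + (i : ℕ) = n := by
  have hp := hA.isPrime
  have hanti : Antitone fun i : Fin (n + 1) ↦
      ringKrullDim (A.carrier ⧸ A.ideal i) + ((i : ℕ) : WithBot ℕ∞) := by
    refine Fin.antitone_iff_succ_le.2 fun i ↦ ?_
    have hlt := hA.strictMono (Fin.castSucc_lt_succ (i := i))
    have h0 : (A.ideal i.succ).map (Ideal.Quotient.mk (A.ideal i.castSucc)) ≠ ⊥ := by
      rw [Ne, map_eq_bot_iff_le_ker, mk_ker]; exact hlt.not_ge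
    have h1 := ringKrullDim_quotient_add_one_le_of_ne_bot h0
    rw [ringKrullDim_eq_of_ringEquiv (DoubleQuot.quotQuotEquivQuotOfLE hlt.le)] at h1
    have h2 := add_le_add_left h1 ((i : ℕ) : WithBot ℕ∞)
    simpa [add_assoc, add_comm] using h2
  refine le_antisymm ?_ ?_
  · refine (hanti (Fin.zero_le i)).trans ?_
    simpa [hA.ringKrullDim_eq] using ringKrullDim_quotient_le (A.ideal 0)
  · refine le_trans ?_ (hanti (Fin.le_last i))
    have : (0 : WithBot ℕ∞) ≤ ringKrullDim (A.carrier ⧸ A.ideal (Fin.last n)) :=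
      ringKrullDim_nonneg_of_nontrivial
    simpa using add_le_add_left this ((n : ℕ) : WithBot ℕ∞)

theorem IsRegular.isPrincipalPrimeChain {n : ℕ} {A : RingChain.{u} n} (hA : A.IsRegular) :
    A.IsPrincipalPrimeChain := by
  have := hA.isRegularLocalRing
  have hp := hA.isPrime
  have hq := hA.isRegularLocalRing_quotient
  have hd := hA.ringKrullDim_quotient_add
  refine ⟨inferInstance, hA.isPrime, ?_, ?_, fun i ↦ ?_⟩
  · by_contra h0
    have : IsDomain A.carrier := IsRegularLocalRing.isDomain
    have h1 := ringKrullDim_quotient_add_one_le_of_ne_bot h0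
    have h2 := hd 0
    simp only [Fin.val_zero, Nat.cast_zero, add_zero] at h2
    rw [h2, hA.ringKrullDim_eq] at h1
    norm_cast at h1
    omega
  · have h1 := hd (Fin.last n)
    rw [Fin.val_last, ← (hq _).spanFinrank_maximalIdeal] at h1
    have h2 : (IsLocalRing.maximalIdeal (A.carrier ⧸ A.ideal (Fin.last n))).spanFinrank = 0 := by
      norm_cast at h1; omega
    rw [Submodule.spanFinrank_eq_zero_iff_eq_bot (fg_of_isNoetherianRing _)] at h2
    exact Ideal.Quotient.maximal_of_isField _ (IsLocalRing.isField_iff_maximalIdeal_eq.2 h2)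
  · have hlt := hA.strictMono (Fin.castSucc_lt_succ (i := i))
    let e := DoubleQuot.quotQuotEquivQuotOfLE hlt.le
    have : IsRegularLocalRing ((A.carrier ⧸ A.ideal i.castSucc) ⧸
      (A.ideal i.succ).map (Ideal.Quotient.mk (A.ideal i.castSucc))) := .of_ringEquiv e.symm
    have : ((A.ideal i.succ).map (Ideal.Quotient.mk (A.ideal i.castSucc))).IsPrime :=
      map_isPrime_of_surjective Ideal.Quotient.mk_surjective (by rw [mk_ker]; exact hlt.le)
    obtain ⟨s, hs⟩ := IsRegularLocalRing.exists_eq_span_singleton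
      (P := (A.ideal i.succ).map (Ideal.Quotient.mk (A.ideal i.castSucc))) (by
        have h1 := hd i.succ
        have h2 := hd i.castSucc
        rw [← (hq _).spanFinrank_maximalIdeal] at h1 h2
        rw [ringKrullDim_eq_of_ringEquiv e, ← (hq _).spanFinrank_maximalIdeal,
          ← (hq _).spanFinrank_maximalIdeal]
        norm_cast at h1 h2 ⊢
        simp at h1 h2
        omega)
    obtain ⟨t, rfl⟩ := Ideal.Quotient.mk_surjective s
    have heq : A.ideal i.succ = A.ideal i.castSucc ⊔ span {t} := by
      have := congrArg (comap (Ideal.Quotient.mk (A.ideal i.castSucc))) hs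
      rwa [← Set.image_singleton, ← map_span, comap_map_mk hlt.le,
        comap_map_of_surjective' _ Ideal.Quotient.mk_surjective, mk_ker, sup_comm] at this
    refine ⟨t, fun ht ↦ hlt.ne ?_, heq⟩
    rw [heq, sup_eq_left.2 ((span_singleton_le_iff_mem _).2 ht)]

end RingChain

/-! ### Adic completions -/

section AdicComplete

open Ideal

theorem IsAdicComplete.of_linearEquiv {R M N : Type*} [CommRing R] {I : Ideal R} [AddCommGroup M]
    [AddCommGroup N] [Module R M] [Module R N] (e : M ≃ₗ[R] N) [h : IsAdicComplete I M] :
    IsAdicComplete I N := by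
  rw [← AdicCompletion.of_bijective_iff] at h ⊢
  have : (AdicCompletion.of I N : N → AdicCompletion I N) =
      AdicCompletion.congr I e ∘ AdicCompletion.of I M ∘ e.symm := by
    ext x : 1
    simp [AdicCompletion.congr, AdicCompletion.map_of]
  rw [this]
  exact (AdicCompletion.congr I e).bijective.comp (h.comp e.symm.bijective)

variable {S : Type u} [CommRing S]

/-- A complete ring is Noetherian if its quotient by an element of the ideal of definition is. -/
theorem IsAdicComplete.isNoetherianRing_of_quotient_span_singleton (J : Ideal S)
    [IsAdicComplete J S] {t : S} (ht : t ∈ J) [IsNoetherianRing (S ⧸ span {t})] :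
    IsNoetherianRing S := by
  have hN : IsNoetherian S (S ⧸ span {t}) :=
    isNoetherian_iff'.2 (Submodule.orderIsoOfAlgebraMapSurjective (R := S) (S := S ⧸ span {t})
      (M := S ⧸ span {t}) Ideal.Quotient.mk_surjective).symm.toOrderEmbedding.wellFoundedGT
  -- Cohen's theorem: it is enough to generate primes finitely.
  refine IsNoetherianRing.of_prime fun P hP ↦ ?_
  let f := (span {t}).mkQ
  have hfg : (Submodule.map f P).FG := hN.noetherian _
  by_cases htP : t ∈ P
  · refine Submodule.fg_of_fg_map_of_fg_inf_ker f hfg ?_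
    have : P ⊓ LinearMap.ker f = span {t} := by
      rw [Submodule.ker_mkQ]; exact inf_eq_right.2 ((span_singleton_le_iff_mem P).2 htP)
    rw [this]
    exact ⟨{t}, by simp⟩
  -- If `t ∉ P`, lifts `x i` of generators modulo `t` already generate `P`: the error `t * z` lies
  -- in `P`, so `z ∈ P` and the division can be repeated. The coefficients are `t`-adic series,
  -- which converge.
  obtain ⟨n, g, hg⟩ := Submodule.fg_iff_exists_fin_generating_family.1 hfg
  have hx (i : Fin n) : ∃ x ∈ P, f x = g i := by
    have : g i ∈ Submodule.map f P := hg ▸ Submodule.subset_span ⟨i, rfl⟩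
    simpa using this
  choose x hxP hxg using hx
  have hstep (y : P) : ∃ (c : Fin n → S) (z : P), (y : S) = ∑ i, c i * x i + t * z := by
    have : f y ∈ Submodule.span S (Set.range g) := hg ▸ Submodule.mem_map_of_mem y.2
    obtain ⟨c, hc⟩ := (Submodule.mem_span_range_iff_exists_fun S).1 this
    have h1 : (y : S) - ∑ i, c i * x i ∈ span {t} := by
      rw [← (span {t}).ker_mkQ, LinearMap.mem_ker, map_sub, sub_eq_zero]
      simp only [← smul_eq_mul, map_sum, map_smul]
      rw [← hc]
      exact Finset.sum_congr rfl fun i _ ↦ by rw [← hxg i]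
    obtain ⟨z, hz⟩ := mem_span_singleton.1 h1
    have hzP : t * z ∈ P := hz ▸ P.sub_mem y.2 (P.sum_mem fun i _ ↦ P.mul_mem_left _ (hxP i))
    exact ⟨c, ⟨z, (hP.mem_or_mem hzP).resolve_left htP⟩, by rw [← hz]; ring⟩
  choose c z hcz using hstep
  refine Submodule.fg_iff_exists_fin_generating_family.2 ⟨n, x, le_antisymm ?_ fun y hy ↦ ?_⟩
  · exact Submodule.span_le.2 (Set.range_subset_iff.2 hxP)
  let w (k : ℕ) : P := z^[k] ⟨y, hy⟩
  let s (i : Fin n) (k : ℕ) : S := ∑ j ∈ Finset.range k, t ^ j * c (w j) i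
  have hw (k : ℕ) : w (k + 1) = z (w k) := Function.iterate_succ_apply' _ _ _
  have hs (k : ℕ) : y = ∑ i, s i k * x i + t ^ k * w k := by
    induction k with
    | zero => simp [s, w]
    | succ k ih =>
      have h1 : ∑ i, s i (k + 1) * x i = ∑ i, s i k * x i + t ^ k * ∑ i, c (w k) i * x i := by
        rw [Finset.mul_sum, ← Finset.sum_add_distrib]
        exact Finset.sum_congr rfl fun i _ ↦ by simp only [s, Finset.sum_range_succ]; ring
      rw [h1, hw]
      nth_rw 1 [ih]
      rw [hcz (w k)]
      ring
  have hlim (i : Fin n) : ∃ L, ∀ k, s i k - L ∈ J ^ k := by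
    obtain ⟨L, hL⟩ := IsPrecomplete.prec (I := J) (M := S) inferInstance (f := s i)
      fun {a b} hab ↦ by
        rw [SModEq.sub_mem, smul_eq_mul, mul_top, ← neg_mem_iff, neg_sub,
          ← Finset.sum_Ico_eq_sub _ hab]
        exact Ideal.sum_mem _ fun j hj ↦ mul_mem_right _ _
          (pow_le_pow_right (Finset.mem_Ico.1 hj).1 (pow_mem_pow ht j))
    exact ⟨L, fun k ↦ by simpa [SModEq.sub_mem] using hL k⟩
  choose L hL using hlim
  refine (Submodule.mem_span_range_iff_exists_fun S).2 ⟨L, ?_⟩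
  rw [← sub_eq_zero, ← neg_eq_zero, neg_sub]
  refine IsHausdorff.haus (I := J) (M := S) inferInstance _ fun k ↦ ?_
  rw [SModEq.zero, smul_eq_mul, mul_top]
  have h2 : y - ∑ i, L i • x i = ∑ i, (s i k - L i) * x i + t ^ k * w k := by
    nth_rw 1 [hs k]
    simp only [sub_mul, Finset.sum_sub_distrib, smul_eq_mul]
    ring
  rw [h2]
  exact add_mem (Ideal.sum_mem _ fun i _ ↦ mul_mem_right _ _ (hL i k))
    (mul_mem_right _ _ (pow_mem_pow ht k))

/-- A ring, separated for an ideal containing a regular element generating a prime, is a domain. -/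
theorem IsHausdorff.isDomain_of_isPrime_span_singleton (J : Ideal S) [IsHausdorff J S] {t : S}
    (ht : t ∈ J) (hreg : ∀ x, t * x = 0 → x = 0) (hp : (span {t}).IsPrime) : IsDomain S := by
  have hnt : Nontrivial S := ⟨0, 1, fun h ↦
    hp.ne_top ((eq_top_iff_one _).2 (h ▸ zero_mem _))⟩
  -- Separatedness lets the full power of `t` be divided out of both factors of a zero product; the
  -- cofactors then contradict primality of `(t)`.
  have hfin {x : S} (hx : x ≠ 0) : FiniteMultiplicity t x := by
    by_contra h
    rw [FiniteMultiplicity.not_iff_forall] at h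
    refine hx (IsHausdorff.haus (I := J) (M := S) inferInstance _ fun k ↦ ?_)
    rw [SModEq.zero, smul_eq_mul, mul_top]
    exact Ideal.mem_of_dvd _ (h k) (pow_mem_pow ht k)
  have hpow (k : ℕ) {x : S} (h : t ^ k * x = 0) : x = 0 := by
    induction k with
    | zero => simpa using h
    | succ k ih => exact ih (hreg _ (by rw [← h]; ring))
  have : NoZeroDivisors S := ⟨fun {a b} hab ↦ by
    by_contra! h
    obtain ⟨a', ha, ha'⟩ := (hfin h.1).exists_eq_pow_mul_and_not_dvd
    obtain ⟨b', hb, hb'⟩ := (hfin h.2).exists_eq_pow_mul_and_not_dvd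
    have h0 : a' * b' = 0 := hpow (multiplicity t a + multiplicity t b) (by
      rw [← hab]; linear_combination -(t ^ multiplicity t b * b') * ha - a * hb)
    rw [← mem_span_singleton] at ha' hb'
    exact (hp.mem_or_mem (h0 ▸ zero_mem _)).elim ha' hb'⟩
  exact NoZeroDivisors.to_isDomain S

namespace AdicCompletion

variable {A : Type u} [CommRing A] [IsNoetherianRing A] (I p : Ideal A)

/-- For Noetherian `A`, the quotient Â/pÂ ≅ Â ⊗ A/p is the `I`-adic completion of the finite module
A/p. -/
theorem isAdicComplete_quotient_map :
    IsAdicComplete (I.map (algebraMap A (AdicCompletion I A ⧸ p.map (algebraMap A (AdicCompletion I A)))))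
      (AdicCompletion I A ⧸ p.map (algebraMap A (AdicCompletion I A))) := by
  rw [IsAdicComplete.map_algebraMap_iff]
  let e := (Algebra.TensorProduct.quotIdealMapEquivTensorQuot (AdicCompletion I A) p).toLinearEquiv ≪≫ₗ
    ofTensorProductEquivOfFiniteNoetherian I (A ⧸ p)
  have : IsAdicComplete I (AdicCompletion I (A ⧸ p)) := isAdicComplete I.fg_of_isNoetherianRing
  exact .of_linearEquiv (e.restrictScalars A).symm

/-- Multiplication by `t` is injective on A/p, and remains so after tensoring with the flat
`A`-module Â. -/
theorem eq_zero_of_algebraMap_mul_eq_zero [p.IsPrime] {t : A} (ht : t ∉ p)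
    {x : AdicCompletion I A ⧸ p.map (algebraMap A (AdicCompletion I A))}
    (hx : algebraMap A _ t * x = 0) : x = 0 := by
  let e := Algebra.TensorProduct.quotIdealMapEquivTensorQuot (AdicCompletion I A) p
  have hinj : Function.Injective (LinearMap.lsmul A (A ⧸ p) t) := by
    rw [injective_iff_map_eq_zero]
    intro a ha
    obtain ⟨a, rfl⟩ := Ideal.Quotient.mk_surjective a
    rw [LinearMap.lsmul_apply, ← Ideal.Quotient.mk_eq_mk, ← Submodule.Quotient.mk_smul,
      Ideal.Quotient.mk_eq_mk, Ideal.Quotient.eq_zero_iff_mem, smul_eq_mul] at ha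
    exact Ideal.Quotient.eq_zero_iff_mem.2 ((Ideal.IsPrime.mem_or_mem ‹_› ha).resolve_left ht)
  have h2 := Module.Flat.lTensor_preserves_injective_linearMap (M := AdicCompletion I A) _ hinj
  have h3 : LinearMap.lTensor (AdicCompletion I A) (LinearMap.lsmul A (A ⧸ p) t) =
      LinearMap.lsmul A _ t := by
    ext; simp
  rw [h3] at h2
  refine e.injective (h2 ?_)
  rw [← Algebra.smul_def] at hx
  have h4 := (e.toLinearEquiv.restrictScalars A).map_smul t x
  rw [hx, _root_.map_zero] at h4
  rw [_root_.map_zero, _root_.map_zero]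
  exact h4.symm

theorem isNoetherianRing_quotient_map_and_isPrime_map {q : Ideal A} [p.IsPrime] {t : A}
    (ht : t ∉ p) (htI : t ∈ I) (hq : q = p ⊔ span {t})
    (hN : IsNoetherianRing (AdicCompletion I A ⧸ q.map (algebraMap A (AdicCompletion I A))))
    (hP : (q.map (algebraMap A (AdicCompletion I A))).IsPrime) :
    IsNoetherianRing (AdicCompletion I A ⧸ p.map (algebraMap A (AdicCompletion I A))) ∧
      (p.map (algebraMap A (AdicCompletion I A))).IsPrime := by
  set pc := p.map (algebraMap A (AdicCompletion I A)) with hpc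
  let S := AdicCompletion I A ⧸ pc
  have hcomp : IsAdicComplete (I.map (algebraMap A S)) S := isAdicComplete_quotient_map I p
  have htS : algebraMap A S t ∈ I.map (algebraMap A S) := mem_map_of_mem _ htI
  have hq' : q.map (algebraMap A (AdicCompletion I A)) =
      pc ⊔ span {algebraMap A (AdicCompletion I A) t} := by
    rw [hq, Ideal.map_sup, map_span, Set.image_singleton]
  have hspan : span {algebraMap A S t} =
      (span {algebraMap A (AdicCompletion I A) t}).map (Ideal.Quotient.mk pc) := by
    rw [map_span, Set.image_singleton]; rfl
  let e : S ⧸ span {algebraMap A S t} ≃+*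
      AdicCompletion I A ⧸ q.map (algebraMap A (AdicCompletion I A)) :=
    (Ideal.quotEquivOfEq hspan).trans
      ((DoubleQuot.quotQuotEquivQuotSup _ _).trans (Ideal.quotEquivOfEq hq'.symm))
  have : IsNoetherianRing (S ⧸ span {algebraMap A S t}) := isNoetherianRing_of_ringEquiv _ e.symm
  have : IsDomain (S ⧸ span {algebraMap A S t}) := e.toMulEquiv.isDomain _
  refine ⟨IsAdicComplete.isNoetherianRing_of_quotient_span_singleton _ htS, ?_⟩
  rw [← Ideal.Quotient.isDomain_iff_prime]
  exact IsHausdorff.isDomain_of_isPrime_span_singleton _ htS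
    (fun x hx ↦ eq_zero_of_algebraMap_mul_eq_zero I p ht hx)
    ((Ideal.Quotient.isDomain_iff_prime _).1 this)

theorem algebraMap_notMem_map [p.IsPrime] {t : A} (ht : t ∉ p)
    (hP : (p.map (algebraMap A (AdicCompletion I A))).IsPrime) :
    algebraMap A (AdicCompletion I A) t ∉ p.map (algebraMap A (AdicCompletion I A)) := by
  intro h
  refine hP.ne_top ((Ideal.eq_top_iff_one _).2 (Ideal.Quotient.eq_zero_iff_mem.1 ?_))
  refine eq_zero_of_algebraMap_mul_eq_zero I p ht ?_
  rw [map_one, mul_one]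
  exact Ideal.Quotient.eq_zero_iff_mem.2 h

end AdicCompletion

end AdicComplete

/-! ### Stability of principal prime chains under completion and localisation -/

namespace RingChain

open Ideal

namespace IsPrincipalPrimeChain

variable {n : ℕ} {A : RingChain.{u} n}

theorem monotone (hA : A.IsPrincipalPrimeChain) : Monotone A.ideal :=
  Fin.monotone_iff_le_succ.2 fun i ↦ by
    obtain ⟨t, -, h⟩ := hA.exists_succ_eq i
    exact h ▸ le_sup_left

/-- Both properties descend together from the field Â/𝔭ₙÂ. At `i = 0`, where the ideal is zero, they
give that Â itself is Noetherian. -/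
theorem comp_isNoetherianRing_quotient_and_isPrime (hA : A.IsPrincipalPrimeChain)
    (i : Fin (n + 1)) :
    IsNoetherianRing (A.comp.carrier ⧸ A.comp.ideal i) ∧ (A.comp.ideal i).IsPrime := by
  have := hA.isNoetherianRing
  let I := A.ideal (Fin.last n)
  induction i using Fin.reverseInduction with
  | last =>
    have := hA.isMaximal
    have hmax : (A.comp.ideal (Fin.last n)).IsMaximal :=
      AdicCompletion.isMaximal_map_of_le _ _ le_rfl I.fg_of_isNoetherianRing
    let := Ideal.Quotient.field (A.comp.ideal (Fin.last n))
    exact ⟨inferInstance, hmax.isPrime⟩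
  | cast i ih =>
    obtain ⟨t, ht, hsucc⟩ := hA.exists_succ_eq i
    have hp := hA.isPrime i.castSucc
    exact AdicCompletion.isNoetherianRing_quotient_map_and_isPrime_map I _ ht
      (hA.monotone (Fin.le_last i.succ) (hsucc ▸ mem_sup_right (mem_span_singleton_self t)))
      hsucc ih.1 ih.2

theorem comp (hA : A.IsPrincipalPrimeChain) : A.comp.IsPrincipalPrimeChain := by
  have := hA.isNoetherianRing
  have := hA.isMaximal
  have h0 : A.comp.ideal 0 = ⊥ := by
    change Ideal.map _ _ = _
    rw [hA.ideal_zero, Ideal.map_bot]; rfl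
  refine ⟨?_, fun i ↦ (hA.comp_isNoetherianRing_quotient_and_isPrime i).2, h0,
    AdicCompletion.isMaximal_map_of_le _ _ le_rfl (fg_of_isNoetherianRing _), fun i ↦ ?_⟩
  · have := (hA.comp_isNoetherianRing_quotient_and_isPrime 0).1
    exact isNoetherianRing_of_ringEquiv (A.comp.carrier ⧸ A.comp.ideal 0)
      ((Ideal.quotEquivOfEq h0).trans (RingEquiv.quotientBot _))
  · obtain ⟨t, ht, hsucc⟩ := hA.exists_succ_eq i
    have hp := hA.isPrime i.castSucc
    have hp' := (hA.comp_isNoetherianRing_quotient_and_isPrime i.castSucc).2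
    refine ⟨algebraMap A.carrier (AdicCompletion _ A.carrier) t, AdicCompletion.algebraMap_notMem_map _ _ ht hp', ?_⟩
    change Ideal.map _ _ = Ideal.map _ _ ⊔ _
    rw [hsucc, Ideal.map_sup, map_span, Set.image_singleton]
    rfl

end IsPrincipalPrimeChain

theorem isLocalization_atPrime_loc {n : ℕ} (A : RingChain.{u} (n + 1))
    [h : (A.ideal (Fin.last n).castSucc).IsPrime] :
    IsLocalization.AtPrime (Localization (nonZeroDivisorsMod (A.ideal (Fin.last n).castSucc)))
      (A.ideal (Fin.last n).castSucc) := by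
  rw [IsLocalization.AtPrime, ← nonZeroDivisorsMod_eq_primeCompl]
  infer_instance

theorem IsPrincipalPrimeChain.loc {n : ℕ} {A : RingChain.{u} (n + 1)}
    (hA : A.IsPrincipalPrimeChain) : A.loc.IsPrincipalPrimeChain := by
  have := hA.isNoetherianRing
  have hp := hA.isPrime
  set p := A.ideal (Fin.last n).castSucc
  let L := Localization (nonZeroDivisorsMod p)
  have hL : IsLocalization.AtPrime L p := isLocalization_atPrime_loc A
  have hdisj (i : Fin (n + 1)) : Disjoint (p.primeCompl : Set A.carrier) (A.ideal i.castSucc) :=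
    Set.disjoint_compl_left_iff_subset.2 (hA.monotone (Fin.castSucc_le_castSucc_iff.2 (Fin.le_last i)))
  refine ⟨IsLocalization.isNoetherianRing (nonZeroDivisorsMod p) L inferInstance,
    fun i ↦ IsLocalization.isPrime_of_isPrime_disjoint p.primeCompl L _ (hp _) (hdisj i), ?_, ?_,
    fun i ↦ ?_⟩
  · change Ideal.map _ _ = _
    rw [show (0 : Fin (n + 1)).castSucc = 0 from rfl, hA.ideal_zero, Ideal.map_bot]; rfl
  · have : IsLocalRing L := IsLocalization.AtPrime.isLocalRing L p
    have h : p.map (algebraMap A.carrier L) = IsLocalRing.maximalIdeal L :=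
      IsLocalization.AtPrime.map_eq_maximalIdeal p L
    change (p.map (algebraMap A.carrier L)).IsMaximal
    rw [h]
    infer_instance
  · obtain ⟨t, ht, hsucc⟩ := hA.exists_succ_eq i.castSucc
    refine ⟨algebraMap A.carrier L t, fun h ↦ ht ?_, ?_⟩
    · have := IsLocalization.under_map_of_isPrime_disjoint p.primeCompl L (hp _) (hdisj i.castSucc)
      rw [← this]
      exact h
    · change Ideal.map _ _ = Ideal.map _ _ ⊔ _
      rw [show i.succ.castSucc = i.castSucc.succ from rfl, hsucc, Ideal.map_sup, map_span,
        Set.image_singleton]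
      rfl

end RingChain

/-! ### Countability and finiteness of residue fields of finite type -/

section FiniteType

theorem Algebra.FiniteType.countable_of_int (S : Type*) [CommRing S] [Algebra.FiniteType ℤ S] :
    Countable S := by
  obtain ⟨n, f, hf⟩ := Algebra.FiniteType.iff_quotient_mvPolynomial''.1
    (inferInstance : Algebra.FiniteType ℤ S)
  have : Countable (MvPolynomial (Fin n) ℤ) := by
    rw [← Cardinal.mk_le_aleph0_iff]
    refine MvPolynomial.cardinalMk_le_max.trans ?_
    simp
  exact hf.countable

theorem Algebra.EssFiniteType.countable_of_int (S : Type*) [CommRing S]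
    [Algebra.EssFiniteType ℤ S] : Countable S := by
  have : Countable (Algebra.EssFiniteType.subalgebra ℤ S) :=
    Algebra.FiniteType.countable_of_int _
  have hs := IsLocalization.mk'_surjective (Algebra.EssFiniteType.submonoid ℤ S) (S := S)
  exact Function.Surjective.countable
    (f := fun p : Algebra.EssFiniteType.subalgebra ℤ S × Algebra.EssFiniteType.submonoid ℤ S ↦
      IsLocalization.mk' S p.1 p.2) fun z ↦ by
        obtain ⟨⟨x, y⟩, h⟩ := hs z
        exact ⟨(x, y), h⟩

theorem Int.isJacobsonRing : IsJacobsonRing ℤ := by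
  refine isJacobsonRing_iff_prime_eq.2 fun P hP ↦ ?_
  rcases eq_or_ne P ⊥ with rfl | h0
  · refine (Submodule.eq_bot_iff _).2 fun x hx ↦ ?_
    -- The unit `3 * x ^ 2 + 1` must be `±1`, so `x = 0`.
    have h1 := Ideal.mem_jacobson_bot.1 hx (3 * x)
    rcases Int.isUnit_iff.1 h1 with h | h <;> nlinarith [sq_nonneg x]
  · exact Ideal.jacobson_eq_self_of_isMaximal (H := hP.isMaximal h0)

/-- By the Nullstellensatz over the Jacobson ring ℤ, `K` is a finite ℤ-module. Integrality excludes
ℤ ⊆ K, since ℤ would then be a field; so a nonzero integer kills `K`, and finitely generated torsion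
is finite. -/
theorem Algebra.FiniteType.finite_of_int (K : Type*) [Field K] [h : Algebra ℤ K] [Algebra.FiniteType ℤ K] :
    Finite K := by
  obtain rfl : h = Ring.toIntAlgebra K := Subsingleton.elim _ _
  have := Int.isJacobsonRing
  have : Module.Finite ℤ K := finite_of_finite_type_of_isJacobsonRing ℤ K
  have hinj : ¬ Function.Injective (algebraMap ℤ K) := fun h ↦
    Int.not_isField (isField_of_isIntegral_of_isField h (Field.toIsField K))
  rw [injective_iff_map_eq_zero] at hinj
  push Not at hinj
  obtain ⟨m, hm, hm0⟩ := hinj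
  refine Module.finite_of_fg_torsion K fun {x} ↦ ⟨⟨m, mem_nonZeroDivisors_of_ne_zero hm0⟩, ?_⟩
  change m • x = 0
  rw [Algebra.smul_def, hm, zero_mul]

end FiniteType

/-! ### Discrete valuation rings and their fraction fields -/

section DiscreteValuationRing

theorem IsDiscreteValuationRing.of_isAdicComplete_span_singleton (D : Type u) [CommRing D]
    [IsDomain D] [IsNoetherianRing D] {t : D} (ht : t ≠ 0) [hmax : (Ideal.span {t}).IsMaximal]
    [hcomp : IsAdicComplete (Ideal.span {t}) D] :
    ∃ _ : IsDiscreteValuationRing D, IsLocalRing.maximalIdeal D = Ideal.span {t} := by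
  have : IsLocalRing D := isLocalRing_of_isAdicComplete_maximal (Ideal.span {t})
  have hm := IsLocalRing.eq_maximalIdeal hmax
  have hf : ¬ IsField D := by
    rw [IsLocalRing.isField_iff_maximalIdeal_eq, ← hm, Ideal.span_singleton_eq_bot]
    exact ht
  exact ⟨((IsDiscreteValuationRing.TFAE D hf).out 0 4 rfl rfl).2 ⟨⟨t, hm.symm⟩⟩, hm.symm⟩

theorem isFractionRing_quotient_map_of_isLocalization {R : Type u} [CommRing R] (p : Ideal R)
    [p.IsPrime] (S : Type u) [CommRing S] [Algebra R S] [IsLocalization.AtPrime S p] :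
    IsFractionRing (R ⧸ p) (S ⧸ p.map (algebraMap R S)) := by
  have h : Algebra.algebraMapSubmonoid (R ⧸ p) p.primeCompl = nonZeroDivisors (R ⧸ p) := by
    ext x
    obtain ⟨x, rfl⟩ := Ideal.Quotient.mk_surjective x
    rw [mem_nonZeroDivisors_iff_ne_zero, Ne, Ideal.Quotient.eq_zero_iff_mem]
    refine ⟨?_, fun hx ↦ ⟨x, hx, rfl⟩⟩
    rintro ⟨y, hy, hyx⟩ hx
    exact hy (Ideal.Quotient.eq_zero_iff_mem.1 (hyx.trans (Ideal.Quotient.eq_zero_iff_mem.2 hx)))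
  have : IsLocalization (Algebra.algebraMapSubmonoid (R ⧸ p) p.primeCompl)
    (S ⧸ p.map (algebraMap R S)) := inferInstance
  rwa [h] at this

theorem exists_ringEquiv_cdvIntegers {D : Type u} [CommRing D] [IsDomain D]
    [IsDiscreteValuationRing D] [IsAdicComplete (IsLocalRing.maximalIdeal D) D]
    {F : Type u} [Field F] [Algebra D F] [IsFractionRing D F] :
    ∃ ψ : D ≃+* cdvIntegers F, ∀ d, (ψ d : F) = algebraMap D F d := by
  let f : D →+* cdvIntegers F := (algebraMap D F).codRestrict (cdvIntegers F).toSubring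
    fun d ↦ (mem_cdvIntegers_iff D).2 ⟨d, rfl⟩
  refine ⟨RingEquiv.ofBijective f ⟨fun a b hab ↦ ?_, fun x ↦ ?_⟩, fun d ↦ rfl⟩
  · exact IsFractionRing.injective D F (congrArg Subtype.val hab)
  · obtain ⟨d, hd⟩ := (mem_cdvIntegers_iff D).1 x.2
    exact ⟨d, Subtype.ext hd⟩

end DiscreteValuationRing

section Dimension

variable {F : Type u} [Field F] {n : ℕ}

theorem le_cdvdim (h : ∀ i < n, IsCDVField (NthResidueField i F)) : (n : ℕ∞) ≤ cdvdim F :=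
  le_iSup₂_of_le n h le_rfl

theorem cdvdim_le (h : ¬ IsCDVField (NthResidueField n F)) : cdvdim F ≤ n :=
  iSup₂_le fun m hm ↦ by
    by_contra! hlt
    exact h (hm n (by exact_mod_cast hlt))

end Dimension

/-! ### Successive residue fields of HL -/

namespace RingChain

open Ideal

namespace IsPrincipalPrimeChain

theorem isMaximal_span_quotient {n : ℕ} {A : RingChain.{u} (n + 1)} (hA : A.IsPrincipalPrimeChain) :
    ∃ t : A.carrier ⧸ A.ideal (Fin.last n).castSucc, t ≠ 0 ∧ (span {t}).IsMaximal ∧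
      (A.ideal (Fin.last (n + 1))).map (Ideal.Quotient.mk _) = span {t} := by
  obtain ⟨t, ht, hsucc⟩ := hA.exists_succ_eq (Fin.last n)
  have hmax := hA.isMaximal
  have h1 : (A.ideal (Fin.last (n + 1))).map (Ideal.Quotient.mk (A.ideal (Fin.last n).castSucc)) =
      span {Ideal.Quotient.mk _ t} := by
    rw [← Fin.succ_last, hsucc, Ideal.map_sup, map_quotient_self, bot_sup_eq, map_span,
      Set.image_singleton]
  refine ⟨Ideal.Quotient.mk _ t, fun h ↦ ht (Ideal.Quotient.eq_zero_iff_mem.1 h), ?_, h1⟩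
  rw [← h1]
  refine Ideal.IsMaximal.map_of_surjective_of_ker_le Ideal.Quotient.mk_surjective ?_
  rw [mk_ker]
  exact hA.monotone (Fin.le_last _)

/-- The residue field of `loc (comp A)` has the complete discrete valuation ring
`Â ⧸ 𝔭ₙ₋₁Â` as a ring of integers. -/
theorem exists_isDiscreteValuationRing {n : ℕ} {A : RingChain.{u} (n + 1)}
    (hA : A.IsPrincipalPrimeChain) :
    ∃ (_ : IsDomain (A.comp.carrier ⧸ A.comp.ideal (Fin.last n).castSucc))
      (_ : IsDiscreteValuationRing (A.comp.carrier ⧸ A.comp.ideal (Fin.last n).castSucc)),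
      IsAdicComplete (IsLocalRing.maximalIdeal
        (A.comp.carrier ⧸ A.comp.ideal (Fin.last n).castSucc))
        (A.comp.carrier ⧸ A.comp.ideal (Fin.last n).castSucc) ∧
      IsLocalRing.maximalIdeal (A.comp.carrier ⧸ A.comp.ideal (Fin.last n).castSucc) =
        (A.comp.ideal (Fin.last (n + 1))).map (Ideal.Quotient.mk _) := by
  have hC := hA.comp
  have := hC.isNoetherianRing
  have := hA.isNoetherianRing
  have hp := hC.isPrime (Fin.last n).castSucc
  obtain ⟨t, ht0, hmax, hspan⟩ := hC.isMaximal_span_quotient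
  have hcomp : IsAdicComplete (span {t})
      (A.comp.carrier ⧸ A.comp.ideal (Fin.last n).castSucc) := by
    have h1 := AdicCompletion.isAdicComplete_quotient_map (A.ideal (Fin.last (n + 1)))
      (A.ideal (Fin.last n).castSucc)
    have h2 : (A.ideal (Fin.last (n + 1))).map (algebraMap A.carrier
        (AdicCompletion (A.ideal (Fin.last (n + 1))) A.carrier ⧸
          (A.ideal (Fin.last n).castSucc).map (algebraMap A.carrier
            (AdicCompletion (A.ideal (Fin.last (n + 1))) A.carrier)))) = span {t} :=
      (Ideal.map_map _ _).symm.trans hspan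
    rw [h2] at h1
    exact h1
  have hdom : IsDomain (A.comp.carrier ⧸ A.comp.ideal (Fin.last n).castSucc) :=
    Ideal.Quotient.isDomain _
  obtain ⟨hdvr, hm⟩ := IsDiscreteValuationRing.of_isAdicComplete_span_singleton _ ht0
  exact ⟨hdom, hdvr, hm ▸ hcomp, hm.trans hspan.symm⟩

/-- The inductive step. The field `F` is arbitrary up to isomorphism so that it can be the last
residue field obtained from the shorter chain. -/
theorem exists_residue_equiv {n : ℕ} {A : RingChain.{u} (n + 1)} (hA : A.IsPrincipalPrimeChain)
    {F : Type u} [Field F] (e : A.comp.loc.residue ≃+* F) :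
    IsCDVField F ∧ ∃ e' : A.residue ≃+* CDVResidueField F, ∀ a, ∃ z : cdvIntegers F,
      (z : F) = e (Ideal.Quotient.mk _ (A.toLocComp a)) ∧
        IsLocalRing.residue _ z = e' (Ideal.Quotient.mk _ a) := by
  have := hA.isNoetherianRing
  obtain ⟨hdom, hdvr, hcomp, hm⟩ := hA.exists_isDiscreteValuationRing
  have hC := hA.comp
  have hp := hC.isPrime (Fin.last n).castSucc
  set D := A.comp.carrier ⧸ A.comp.ideal (Fin.last n).castSucc
  have hloc := isLocalization_atPrime_loc A.comp
  let K := Localization (nonZeroDivisorsMod (A.comp.ideal (Fin.last n).castSucc)) ⧸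
    (A.comp.ideal (Fin.last n).castSucc).map (algebraMap A.comp.carrier
      (Localization (nonZeroDivisorsMod (A.comp.ideal (Fin.last n).castSucc))))
  have hfrac : IsFractionRing D K := isFractionRing_quotient_map_of_isLocalization _ _
  let eK : K ≃+* F := e
  -- Transport along `e` makes `F` a fraction field of the complete discrete valuation ring `D`.
  let := (eK.toRingHom.comp (algebraMap D K)).toAlgebra
  have hfracF : IsFractionRing D F :=
    IsLocalization.isLocalization_of_algEquiv (nonZeroDivisors D)
      (AlgEquiv.ofRingEquiv (f := eK) fun _ ↦ rfl)
  refine ⟨⟨_, isCompleteDiscreteValuation_of_isAdicComplete (F := F) D⟩, ?_⟩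
  obtain ⟨ψ, hψ⟩ := exists_ringEquiv_cdvIntegers (D := D) (F := F)
  let c : A.carrier →+* A.comp.carrier := algebraMap A.carrier
    (AdicCompletion (A.ideal (Fin.last (n + 1))) A.carrier)
  let q : A.comp.carrier →+* D := Ideal.Quotient.mk _
  let g : A.carrier →+* CDVResidueField F :=
    (IsLocalRing.residue (cdvIntegers F)).comp (ψ.toRingHom.comp (q.comp c))
  have hle : A.comp.ideal (Fin.last n).castSucc ≤ A.comp.ideal (Fin.last (n + 1)) :=
    hC.monotone (Fin.le_last _)
  have hres (x : A.comp.carrier) : IsLocalRing.residue (cdvIntegers F) (ψ (q x)) = 0 ↔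
      x ∈ A.comp.ideal (Fin.last (n + 1)) := by
    rw [IsLocalRing.residue_eq_zero_iff, IsLocalRing.mem_maximalIdeal, mem_nonunits_iff,
      MulEquiv.isUnit_map ψ, ← mem_nonunits_iff, ← IsLocalRing.mem_maximalIdeal, hm,
      ← Ideal.mem_comap, Ideal.comap_map_mk hle]
  have hker (x : A.comp.carrier) : x ∈ A.comp.ideal (Fin.last (n + 1)) ↔
      AdicCompletion.evalOneₐ (A.ideal (Fin.last (n + 1))) x = 0 := by
    have h1 := AdicCompletion.ker_evalOneₐ_eq_map (A.ideal (Fin.last (n + 1)))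
      (fg_of_isNoetherianRing _)
    exact (SetLike.ext_iff.1 h1 x).symm
  have heval (a : A.carrier) : AdicCompletion.evalOneₐ (A.ideal (Fin.last (n + 1))) (c a) =
      Ideal.Quotient.mk _ a := rfl
  have hgker : RingHom.ker g = A.ideal (Fin.last (n + 1)) := by
    ext a
    rw [RingHom.mem_ker]
    change IsLocalRing.residue (cdvIntegers F) (ψ (q (c a))) = 0 ↔ _
    rw [hres, hker, heval, Ideal.Quotient.eq_zero_iff_mem]
  -- Every element of Â agrees with an element of `A` modulo 𝔭ₙÂ.
  have hgsurj : Function.Surjective g := by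
    intro y
    obtain ⟨z, rfl⟩ := IsLocalRing.residue_surjective y
    obtain ⟨d, rfl⟩ := ψ.surjective z
    obtain ⟨x, rfl⟩ := Ideal.Quotient.mk_surjective d
    obtain ⟨a, ha⟩ := Ideal.Quotient.mk_surjective
      (AdicCompletion.evalOneₐ (A.ideal (Fin.last (n + 1))) x)
    refine ⟨a, ?_⟩
    have h0 : IsLocalRing.residue (cdvIntegers F) (ψ (q (c a - x))) = 0 := by
      rw [hres, hker]
      exact (map_sub (AdicCompletion.evalOneₐ (A.ideal (Fin.last (n + 1)))) (c a) x).trans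
        (sub_eq_zero.2 ((heval a).trans ha))
    rw [map_sub, map_sub, map_sub, sub_eq_zero] at h0
    exact h0
  refine ⟨(Ideal.quotEquivOfEq hgker.symm).trans (RingHom.quotientKerEquivOfSurjective hgsurj),
    fun a ↦ ⟨ψ (q (c a)), hψ _, rfl⟩⟩

theorem exists_isField_HL {n : ℕ} {A : RingChain.{u} n} (hA : A.IsPrincipalPrimeChain) :
    ∃ hF : IsField A.HL,
      letI : Field A.HL := hF.toField
      (∀ i < n, IsCDVField (NthResidueField i A.HL)) ∧
      ∃ e : A.residue ≃+* NthResidueField n A.HL,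
        ∀ a : A.carrier, ReducesTo A.HL n (A.toHL a) (e (Ideal.Quotient.mk _ a)) := by
  induction n with
  | zero =>
    have h0 : A.ideal (Fin.last 0) = ⊥ := hA.ideal_zero
    have hmax := hA.isMaximal
    let e0 : A.residue ≃+* A.carrier := (Ideal.quotEquivOfEq h0).trans (RingEquiv.quotientBot _)
    have hF : IsField A.carrier :=
      e0.symm.toMulEquiv.isField ((Ideal.Quotient.maximal_ideal_iff_isField_quotient _).1 hmax)
    exact ⟨hF, fun i hi ↦ absurd hi (Nat.not_lt_zero i), e0, fun a ↦ rfl⟩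
  | succ n ih =>
    obtain ⟨hF, hcdv, e, he⟩ := ih hA.comp.loc
    let : Field A.comp.loc.HL := hF.toField
    obtain ⟨h1, e', he'⟩ := hA.exists_residue_equiv e
    refine ⟨hF, fun i hi ↦ ?_, e', fun a ↦ ?_⟩
    · rcases (Nat.lt_succ_iff_lt_or_eq.1 hi) with hi | rfl
      · exact hcdv i hi
      · exact h1
    · obtain ⟨z, hz, hz'⟩ := he' a
      refine ⟨z, ?_, hz'⟩
      have := he (A.toLocComp a)
      rw [← hz] at this
      exact this

end IsPrincipalPrimeChain

end RingChain

theorem mainTheorem3 (n : ℕ) (A : RingChain.{u} n) (hA : A.IsRegular) :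
    ∃ hF : IsField A.HL,
      letI : Field A.HL := hF.toField
      (n : ℕ∞) ≤ cdvdim A.HL ∧
      (∃ e : A.residue ≃+* NthResidueField n A.HL,
        ∀ a : A.carrier, ReducesTo A.HL n (A.toHL a) (e (Ideal.Quotient.mk _ a))) ∧
      (Algebra.EssFiniteType ℤ A.carrier → cdvdim A.HL = n) ∧
      (∀ (B : Type v) [CommRing B] [Algebra.FiniteType ℤ B] [Algebra B A.carrier]
        (m : Ideal B) [m.IsMaximal] [IsLocalization.AtPrime A.carrier m],
        IsHigherLocalField n A.HL) := by
  have hA' := hA.isPrincipalPrimeChain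
  obtain ⟨hF, hcdv, e, he⟩ := hA'.exists_isField_HL
  let : Field A.HL := hF.toField
  have hdim (h : Algebra.EssFiniteType ℤ A.carrier) : cdvdim A.HL = n := by
    -- A further reduction would require the countable field k(A) to be a complete discrete
    -- valuation field.
    refine le_antisymm (cdvdim_le fun hc ↦ hc.not_countable ?_) (le_cdvdim hcdv)
    have : Countable A.carrier := Algebra.EssFiniteType.countable_of_int A.carrier
    have : Countable A.residue := Ideal.Quotient.mk_surjective.countable
    exact e.surjective.countable
  refine ⟨hF, le_cdvdim hcdv, ⟨e, he⟩, hdim, fun B _ _ _ m _ _ ↦ ⟨hdim ?_, ?_⟩⟩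
  · have : Algebra.EssFiniteType B A.carrier := .of_isLocalization _ m.primeCompl
    exact .comp ℤ B A.carrier
  · have := hA.isRegularLocalRing
    have hmax := IsLocalRing.eq_maximalIdeal hA'.isMaximal
    have : Finite (B ⧸ m) := by
      let := Ideal.Quotient.field m
      exact Algebra.FiniteType.finite_of_int (B ⧸ m)
    let e1 := IsLocalization.AtPrime.equivQuotMaximalIdeal m A.carrier
    let e2 : (B ⧸ m) ≃+* NthResidueField n A.HL :=
      e1.trans ((Ideal.quotEquivOfEq hmax.symm).trans e)
    exact Finite.of_equiv _ e2.toEquiv
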